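/- Let $F$ be an arbitrary field, let $\mathbb N=\{1,2,3,\dots\}$, and let $f:\mathbb N\to\mathbb N$ be a monotone (non-decreasing) function which is submultiplicative, i.e. $f(m+n)\le f(m)f(n)$ for all $m,n\in\mathbb N$, and for which there is an integer $C>0$ with $f(Cn)\ge n f(n)$ for all $n\in\mathbb N$. Then there is a finitely generated prime monomial algebra $B$ over $F$ which has growth type equivalent to $f$ and contains a nonzero locally nilpotent ideal. More precisely, there are an integer $d\ge 0$ and a set $S$ of words in the letters $x_1,\dots,x_{d+1}$ such that the algebra $B=F\langle x_1,\dots,x_{d+1}\rangle/(S)$ has the following properties. 1. $B$ is prime: $B\ne 0$, and if $aBb=0$ with $a,b\in B$, then $a=0$ or $b=0$. 2. $B$ has growth type equivalent to $f$: for every finite-dimensional subspace $V\subseteq B$ generating $B$ as a unital $F$-algebra, the function $g_V(n)=\dim_F(F+V+V^2+\dots+V^n)$ satisfies $g_V\sim f$, i.e. there are integers $C',D'>0$ with $f(n)\le g_V(C'n)\le f(D'n)$ for all $n\in\mathbb N$. 3. The two-sided ideal $I=Bx_{d+1}B$ generated by the image of $x_{d+1}$ is nonzero and locally nilpotent: every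 finitely generated non-unital $F$-subalgebra $T\subseteq I$ satisfies $T^n=0$ for some $n\ge 1$. 4. The $x_{d+1}$-degree of nonzero monomials grows at most logarithmically: there is a constant $K$ such that every word $w$ of length $n$ in $x_1,\dots,x_{d+1}$ whose image in $B$ is nonzero contains the letter $x_{d+1}$ at most $K(\lfloor\log_2 n\rfloor+1)$ times (with the convention $\lfloor\log_2 0\rfloor=0$ for the empty word). -/

import Mathlib

/-- The monomial `x_{i₁} ⋯ x_{i_r}` of the free algebra attached to the word `i₁ ⋯ i_r`. -/
noncomputable def wordMonomial (F : Type*) [Field F] {X : Type*} (w : FreeMonoid X) :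
    FreeAlgebra F X :=
  FreeMonoid.lift (FreeAlgebra.ι F) w

/-- The two-sided ideal of the free algebra generated by the monomials of a set of words. -/
noncomputable def monomialIdeal (F : Type*) [Field F] {X : Type*} (S : Set (FreeMonoid X)) :
    TwoSidedIdeal (FreeAlgebra F X) :=
  TwoSidedIdeal.span (wordMonomial F '' S)

/-- The monomial algebra `F⟨X⟩ / (S)`: the quotient of the free (unital, associative) algebra by
the ideal generated by an arbitrary set `S` of monomials. -/
abbrev MonomialAlgebra (F : Type*) [Field F] {X : Type*} (S : Set (FreeMonoid X)) : Type _ :=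
  (monomialIdeal F S).ringCon.Quotient

/-- The image of a word in the monomial algebra. -/
noncomputable def MonomialAlgebra.word (F : Type*) [Field F] {X : Type*} (S : Set (FreeMonoid X))
    (w : FreeMonoid X) : MonomialAlgebra F S :=
  (monomialIdeal F S).ringCon.mk' (wordMonomial F w)

/-- A (not necessarily commutative) ring is prime if it is nonzero and `a R b = 0` implies
`a = 0` or `b = 0`. -/
def IsPrimeRing (R : Type*) [Ring R] : Prop :=
  Nontrivial R ∧ ∀ a b : R, (∀ r : R, a * r * b = 0) → a = 0 ∨ b = 0

/-- A two-sided ideal of an `F`-algebra is locally nilpotent if every finitely generated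
(non-unital) subalgebra `T` contained in it is nilpotent, i.e. satisfies `T ^ n = 0` for
some `n ≥ 1`. -/
def IsLocallyNilpotentIdeal (F : Type*) [Field F] {A : Type*} [Ring A] [Algebra F A]
    (I : TwoSidedIdeal A) : Prop :=
  ∀ s : Finset A, (∀ x ∈ s, x ∈ I) →
    ∃ n : ℕ, 0 < n ∧ ∀ l : List A, l.length = n →
      (∀ y ∈ l, y ∈ NonUnitalAlgebra.adjoin F (s : Set A)) → l.prod = 0

/-- The growth function of an algebra with respect to a subspace `V`:
`n ↦ dim (F + V + V² + ⋯ + Vⁿ)`. -/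
noncomputable def growthFunction (F : Type*) [Field F] {A : Type*} [Ring A] [Algebra F A]
    (V : Submodule F A) (n : ℕ) : ℕ :=
  Module.finrank F (⨆ i ∈ Finset.range (n + 1), V ^ i : Submodule F A)

/-- `f ∼ g`: there are `C, D > 0` with `f n ≤ g (C n) ≤ f (D n)` for all `n ≥ 1`. -/
def GrowthEquiv (f : ℕ+ → ℕ+) (g : ℕ → ℕ) : Prop :=
  ∃ C D : ℕ+, ∀ n : ℕ+, (f n : ℕ) ≤ g (C * n : ℕ+) ∧ g (C * n : ℕ+) ≤ (f (D * n) : ℕ)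

/-- The finitely generated algebra `A` has growth type `∼ f`: it is finitely generated, and its
growth function with respect to any finite-dimensional generating subspace is equivalent
to `f`. -/
def HasGrowthType (F : Type*) [Field F] (A : Type*) [Ring A] [Algebra F A]
    (f : ℕ+ → ℕ+) : Prop :=
  Algebra.FiniteType F A ∧
    ∀ V : Submodule F A, V.FG → Algebra.adjoin F (V : Set A) = ⊤ →
      GrowthEquiv f (growthFunction F V)

/-! Put `p n = f (2 ^ n)`, `d = f 1`, and let `y` be the last of `d + 1` letters. Starting from the
letters `W 0`, build words of length `2 ^ n` by `W (n + 1) = C n · W n` with `C n ⊆ W n`; the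
nonzero words of the algebra are the factors of these. Let `C n` consist of `k n = ⌈p (n + 1) / p
n⌉` words without `y` and at most one extra word (`exists_blockSystem`). Then `W n` has at least `p
n` words, and at most `2 * 4 ^ n * p n`. Short factors lie in a product of a word of `W n` and one
of `C n`, in either order, so counting factors costs only a further polynomial factor in `2 ^ n`.
Iterating `n * f n ≤ f (C * n)` absorbs all such factors (`exists_language`). The extra words give
primeness: every factor `u` enters some arbitrarily late `C m`, whose words may be followed by all
of `W m` (`language_prime`). They carry at most `b m = v₂ (m + 1)` letters `y`, and `∑ b i = v₂ (n!)
≤ n`, so `y` occurs only logarithmically often (`count_le_log`). On the algebra side, nonzero words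
form a basis, which reduces primeness and growth to words. In a product of `N` elements from a
finitely generated subalgebra of the ideal of `y`, words have some `k ≥ N` letters `y` and length
`O(k)`, against the logarithmic bound; hence such products vanish for large `N`. -/

/-! ### Block systems and their factor languages. -/

open Finset in
/-- A sequence of sets `W n` of words of length `2 ^ n`, in which each word of `W (n + 1)` is the
product of a word of the subset `C n ⊆ W n` and a word of `W n`. The words of `C n` contain the
distinguished letter `y` at most `b n` times, and every word is captured by some `C m`. -/
structure BlockSystem (α : Type*) [DecidableEq α] [Fintype α] (y : α) where
  W : ℕ → Finset (List α)
  C : ℕ → Finset (List α)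
  b : ℕ → ℕ
  W_zero : W 0 = univ.image fun a => [a]
  W_succ : ∀ n, W (n + 1) = image₂ (· ++ ·) (C n) (W n)
  C_subset : ∀ n, C n ⊆ W n
  count_le : ∀ n, ∀ w ∈ C n, w.count y ≤ b n
  sum_b_le : ∀ n, ∑ i ∈ range n, b i ≤ n
  exists_free : ∀ n, ∃ w ∈ C n, w.count y = 0
  capture : ∀ (u : List α) (N : ℕ), ∃ m ≥ N, ∀ v ∈ W m, u <:+: v → v.count y ≤ N →
    ∃ c ∈ C m, u <:+: c

namespace BlockSystem

variable {α : Type*} [DecidableEq α] [Fintype α] {y : α} (B : BlockSystem α y)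

/-- The factors of the words of a block system. -/
def language : Set (List α) := {u | ∃ n, ∃ v ∈ B.W n, u <:+: v}

theorem mem_W_succ {n : ℕ} {w : List α} :
    w ∈ B.W (n + 1) ↔ ∃ c ∈ B.C n, ∃ v ∈ B.W n, c ++ v = w := by
  simp [B.W_succ, Finset.mem_image₂]

theorem length_of_mem_W {n : ℕ} {w : List α} (hw : w ∈ B.W n) : w.length = 2 ^ n := by
  induction n generalizing w with
  | zero =>
    rw [B.W_zero] at hw
    obtain ⟨a, -, rfl⟩ := Finset.mem_image.1 hw
    simp
  | succ n ih =>
    obtain ⟨c, hc, v, hv, rfl⟩ := B.mem_W_succ.1 hw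
    rw [List.length_append, ih (B.C_subset n hc), ih hv, pow_succ]
    ring

theorem count_le_of_mem_W {n : ℕ} {w : List α} (hw : w ∈ B.W n) : w.count y ≤ n + 1 := by
  suffices h : w.count y ≤ 1 + ∑ i ∈ Finset.range n, B.b i by
    have := B.sum_b_le n
    omega
  induction n generalizing w with
  | zero => simpa [B.length_of_mem_W hw] using List.count_le_length (a := y) (l := w)
  | succ n ih =>
    obtain ⟨c, hc, v, hv, rfl⟩ := B.mem_W_succ.1 hw
    rw [List.count_append, Finset.sum_range_succ]
    have := ih hv
    have := B.count_le n c hc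
    omega

/-- Prepending `y`-free words of `C n`, `C (n + 1)`, … raises the level without spending any `y`. -/
theorem exists_extension {n m : ℕ} (h : n ≤ m) {v : List α} (hv : v ∈ B.W n) :
    ∃ v' ∈ B.W m, v <:+ v' ∧ v'.count y = v.count y := by
  induction m, h using Nat.le_induction with
  | base => exact ⟨v, hv, List.suffix_rfl, rfl⟩
  | succ m _ ih =>
    obtain ⟨v', hv', hs, hc⟩ := ih
    obtain ⟨c, hcm, hc0⟩ := B.exists_free m
    exact ⟨c ++ v', B.mem_W_succ.2 ⟨c, hcm, v', hv', rfl⟩,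
      hs.trans (List.suffix_append _ _), by rw [List.count_append, hc0, hc, zero_add]⟩

theorem language_of_infix {u v : List α} (h : u <:+: v) (hv : v ∈ B.language) :
    u ∈ B.language := by
  obtain ⟨n, w, hw, hvw⟩ := hv
  exact ⟨n, w, hw, h.trans hvw⟩

theorem W_subset_language {n : ℕ} {w : List α} (hw : w ∈ B.W n) : w ∈ B.language :=
  ⟨n, w, hw, List.infix_rfl⟩

theorem singleton_mem_language (a : α) : [a] ∈ B.language :=
  B.W_subset_language (n := 0) (by simp [B.W_zero])

theorem language_prime {u v : List α} (hu : u ∈ B.language) (hv : v ∈ B.language) :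
    ∃ w, u ++ w ++ v ∈ B.language := by
  obtain ⟨n, u', hu', huu⟩ := hu
  obtain ⟨k, v', hv', hvv⟩ := hv
  -- The sum makes `m` at least both levels `n` and `k`, and leaves room for the letters `y` of the
  -- extension of `u'`.
  obtain ⟨m, hm, hcap⟩ := B.capture u (n + k + u'.count y)
  obtain ⟨u'', hu'', hs, hcount⟩ := B.exists_extension (m := m) (by omega) hu'
  obtain ⟨c, hc, huc⟩ := hcap u'' hu'' (huu.trans hs.isInfix) (by omega)
  obtain ⟨v'', hv'', hs', -⟩ := B.exists_extension (m := m) (by omega) hv'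
  obtain ⟨p, q, rfl⟩ := huc
  obtain ⟨r, s, rfl⟩ := hvv.trans hs'.isInfix
  refine ⟨q ++ r, m + 1, _, B.mem_W_succ.2 ⟨_, hc, _, hv'', rfl⟩, p, s, ?_⟩
  simp

/-- The words `v ++ c` and `c ++ v` for `v ∈ W n`, `c ∈ C n`. -/
def pairs (n : ℕ) : Finset (List α) :=
  Finset.image₂ (· ++ ·) (B.W n) (B.C n) ∪ Finset.image₂ (· ++ ·) (B.C n) (B.W n)

theorem exists_suffix {n m : ℕ} (h : n ≤ m) {v : List α} (hv : v ∈ B.W m) :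
    ∃ w ∈ B.W n, w <:+ v := by
  induction m, h using Nat.le_induction generalizing v with
  | base => exact ⟨v, hv, List.suffix_rfl⟩
  | succ m _ ih =>
    obtain ⟨c, hc, v', hv', rfl⟩ := B.mem_W_succ.1 hv
    obtain ⟨w, hw, hs⟩ := ih hv'
    exact ⟨w, hw, hs.trans (List.suffix_append _ _)⟩

theorem exists_prefix {n m : ℕ} (h : n + 1 ≤ m) {v : List α} (hv : v ∈ B.W m) :
    ∃ w ∈ B.C n, w <+: v := by
  induction m, h using Nat.le_induction generalizing v with
  | base =>
    obtain ⟨c, hc, v', hv', rfl⟩ := B.mem_W_succ.1 hv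
    exact ⟨c, hc, List.prefix_append _ _⟩
  | succ m _ ih =>
    obtain ⟨c, hc, v', hv', rfl⟩ := B.mem_W_succ.1 hv
    obtain ⟨w, hw, hs⟩ := ih (B.C_subset m hc)
    exact ⟨w, hw, hs.trans (List.prefix_append _ _)⟩

/-- A factor straddling the junction of `c ++ w` sees only the last `2 ^ n` letters of `c`, a word
of `W n`, and the first `2 ^ n` of `w`, a word of `C n`. That one side lies in the smaller set `C n`
is what keeps the count near `p (n + 1)` instead of `p n ^ 2`. -/
theorem exists_pair_of_infix {n m : ℕ} (h : n + 1 ≤ m) {u v : List α} (hv : v ∈ B.W m)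
    (huv : u <:+: v) (hu : u.length ≤ 2 ^ n) : ∃ p ∈ B.pairs n, u <:+: p := by
  induction m, h using Nat.le_induction generalizing v with
  | base =>
    refine ⟨v, ?_, huv⟩
    rw [B.W_succ] at hv
    exact Finset.mem_union_right _ hv
  | succ m hm ih =>
    obtain ⟨c, hc, w, hw, rfl⟩ := B.mem_W_succ.1 hv
    rcases List.infix_append_iff.1 huv with h | h | ⟨s, p, rfl, hs, hp⟩
    · exact ih (B.C_subset m hc) h
    · exact ih hw h
    · obtain ⟨s', hs', hsc⟩ := B.exists_suffix (n := n) (by omega) (B.C_subset m hc)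
      obtain ⟨p', hp', hpw⟩ := B.exists_prefix (n := n) hm hw
      rw [List.length_append] at hu
      have h1 : s <:+ s' := List.suffix_of_suffix_length_le hs hsc
        (by rw [B.length_of_mem_W hs']; omega)
      have h2 : p <+: p' := List.prefix_of_prefix_length_le hp hpw
        (by rw [B.length_of_mem_W (B.C_subset n hp')]; omega)
      refine ⟨s' ++ p', Finset.mem_union_left _ (Finset.mem_image₂_of_mem hs' hp'), ?_⟩
      obtain ⟨a, rfl⟩ := h1
      obtain ⟨b, rfl⟩ := h2
      exact ⟨a, b, by simp⟩

theorem exists_pair {n : ℕ} {u : List α} (hu : u ∈ B.language) (hn : u.length ≤ 2 ^ n) :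
    ∃ p ∈ B.pairs n, u <:+: p := by
  obtain ⟨k, v, hv, huv⟩ := hu
  obtain ⟨v', hv', hs, -⟩ := B.exists_extension (m := n + 1 + k) (by omega) hv
  exact B.exists_pair_of_infix (by omega) hv' (huv.trans hs.isInfix) hn

theorem length_of_mem_pairs {n : ℕ} {p : List α} (hp : p ∈ B.pairs n) :
    p.length = 2 ^ (n + 1) := by
  rcases Finset.mem_union.1 hp with hp | hp <;>
  · obtain ⟨u, hu, v, hv, rfl⟩ := Finset.mem_image₂.1 hp
    rw [List.length_append]
    first
    | rw [B.length_of_mem_W hu, B.length_of_mem_W (B.C_subset n hv), pow_succ, mul_two]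
    | rw [B.length_of_mem_W hv, B.length_of_mem_W (B.C_subset n hu), pow_succ, mul_two]

theorem count_le_of_mem_pairs {n : ℕ} {p : List α} (hp : p ∈ B.pairs n) :
    p.count y ≤ 2 * (n + 1) := by
  have key : ∀ u ∈ B.W n, ∀ v ∈ B.W n, (u ++ v).count y ≤ 2 * (n + 1) := by
    intro u hu v hv
    have := B.count_le_of_mem_W hu
    have := B.count_le_of_mem_W hv
    rw [List.count_append]
    omega
  rcases Finset.mem_union.1 hp with hp | hp
  · obtain ⟨u, hu, v, hv, rfl⟩ := Finset.mem_image₂.1 hp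
    exact key _ hu _ (B.C_subset n hv)
  · obtain ⟨u, hu, v, hv, rfl⟩ := Finset.mem_image₂.1 hp
    exact key _ (B.C_subset n hu) _ hv

theorem card_pairs_le (n : ℕ) : (B.pairs n).card ≤ 2 * ((B.C n).card * (B.W n).card) := by
  have h1 := Finset.card_image₂_le (fun u v : List α => u ++ v) (B.W n) (B.C n)
  have h2 := Finset.card_image₂_le (fun u v : List α => u ++ v) (B.C n) (B.W n)
  have := Finset.card_union_le (Finset.image₂ (fun u v : List α => u ++ v) (B.W n) (B.C n))
    (Finset.image₂ (fun u v : List α => u ++ v) (B.C n) (B.W n))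
  rw [mul_comm] at h1
  unfold pairs
  linarith

theorem count_le_log {w : List α} (hw : w ∈ B.language) :
    w.count y ≤ 4 * (Nat.log 2 w.length + 1) := by
  obtain ⟨p, hp, hwp⟩ := B.exists_pair (n := Nat.log 2 w.length + 1) hw
    (Nat.lt_pow_succ_log_self (by norm_num) _).le
  have h1 := B.count_le_of_mem_pairs hp
  have h2 := hwp.sublist.count_le y
  omega

/-- A word is recovered from a pair containing it, its starting position and its length. -/
theorem ncard_language_le (n : ℕ) : {w ∈ B.language | w.length ≤ 2 ^ n}.ncard ≤
    2 * ((B.C n).card * (B.W n).card) * (2 ^ (n + 1) + 1) ^ 2 := by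
  set M := 2 ^ (n + 1)
  let T := (B.pairs n ×ˢ (Finset.range (M + 1) ×ˢ Finset.range (M + 1))).image
    fun q => (q.1.drop q.2.1).take q.2.2
  have hT : {w ∈ B.language | w.length ≤ 2 ^ n} ⊆ (T : Set (List α)) := by
    rintro w ⟨hw, hl⟩
    obtain ⟨p, hp, hwp⟩ := B.exists_pair hw hl
    have hlp : p.length = M := B.length_of_mem_pairs hp
    obtain ⟨s, t, rfl⟩ := hwp
    simp only [List.length_append] at hlp
    refine Finset.mem_coe.2 (Finset.mem_image.2 ⟨(s ++ w ++ t, s.length, w.length), ?_, ?_⟩)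
    · simp only [Finset.mem_product, Finset.mem_range]
      exact ⟨hp, by omega, by omega⟩
    · simp
  calc _ ≤ (T : Set (List α)).ncard := Set.ncard_le_ncard hT (Finset.finite_toSet T)
    _ = T.card := Set.ncard_coe_finset T
    _ ≤ _ := Finset.card_image_le
    _ = (B.pairs n).card * (M + 1) ^ 2 := by
      rw [Finset.card_product, Finset.card_product, Finset.card_range, sq]
    _ ≤ _ := Nat.mul_le_mul_right _ (B.card_pairs_le n)

theorem card_W_le_ncard (n N : ℕ) (h : 2 ^ n ≤ N) :
    (B.W n).card ≤ {w ∈ B.language | w.length ≤ N}.ncard := by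
  rw [← Set.ncard_coe_finset]
  refine Set.ncard_le_ncard (fun w hw => ⟨B.W_subset_language hw, ?_⟩)
    ((List.finite_length_le α N).subset fun w hw => hw.2)
  rwa [B.length_of_mem_W hw]

end BlockSystem

/-! ### Construction of a block system with prescribed sizes. -/

theorem sum_padicValNat_two_le (n : ℕ) :
    ∑ i ∈ Finset.range n, padicValNat 2 (i + 1) ≤ n := by
  have key : ∑ i ∈ Finset.range n, padicValNat 2 (i + 1) = padicValNat 2 n.factorial := by
    induction n with
    | zero => simp
    | succ n ih =>
      rw [Finset.sum_range_succ, ih, Nat.factorial_succ,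
        padicValNat.mul (by omega) n.factorial_ne_zero, add_comm]
  rcases eq_or_ne n 0 with rfl | hn
  · simp
  · have := sub_one_mul_padicValNat_factorial_lt_of_ne_zero (p := 2) hn
    omega

-- One step of the recursion. The supply of `y`-free words is a premise inside the conclusion, so
-- that `C` can be chosen for every `W` before the sizes are known.
open Finset in
theorem exists_block_step {α : Type*} [DecidableEq α] (y : α) (k b : ℕ) (u : List α)
    (W : Finset (List α)) :
    ∃ C ⊆ W, #C ≤ k + 1 ∧ (∀ w ∈ C, w.count y ≤ b) ∧
      (k ≤ #{w ∈ W | w.count y = 0} → k ≤ #{w ∈ C | w.count y = 0}) ∧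
      ∀ v ∈ W, u <:+: v → v.count y ≤ b → ∃ c ∈ C, u <:+: c := by
  obtain ⟨A, hA, hAc⟩ := exists_subset_card_eq (s := {w ∈ W | w.count y = 0})
    (min_le_right k #{w ∈ W | w.count y = 0})
  have hAW : A ⊆ W := hA.trans (filter_subset _ _)
  have hA0 : ∀ w ∈ A, w.count y = 0 := fun w hw => (mem_filter.1 (hA hw)).2
  have hfree : ∀ C, A ⊆ C → k ≤ #{w ∈ W | w.count y = 0} → k ≤ #{w ∈ C | w.count y = 0} := by
    intro C hC hk
    calc k = #A := by rw [hAc, min_eq_left hk]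
      _ ≤ _ := card_le_card fun w hw => mem_filter.2 ⟨hC hw, hA0 w hw⟩
  by_cases h : ∃ v ∈ W, u <:+: v ∧ v.count y ≤ b
  · obtain ⟨v, hv, huv, hvb⟩ := h
    refine ⟨insert v A, insert_subset hv hAW, ?_, ?_, hfree _ (subset_insert _ _),
      fun _ _ _ _ => ⟨v, mem_insert_self _ _, huv⟩⟩
    · have := card_insert_le v A
      omega
    · intro w hw
      rcases mem_insert.1 hw with rfl | hw
      · exact hvb
      · simp [hA0 w hw]
  · exact ⟨A, hAW, by omega, fun w hw => by simp [hA0 w hw], hfree _ subset_rfl,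
      fun v hv huv hvb => absurd ⟨v, hv, huv, hvb⟩ h⟩

open Finset in
theorem exists_blockSystem {α : Type*} [DecidableEq α] [Fintype α] (y : α) (k : ℕ → ℕ)
    (hk : ∀ n, 1 ≤ k n)
    (hk' : ∀ n, k n ≤ (Fintype.card α - 1) * ∏ i ∈ range n, k i) :
    ∃ B : BlockSystem α y, (∀ n, #(B.C n) ≤ k n + 1) ∧
      ∀ n, (Fintype.card α - 1) * ∏ i ∈ range n, k i ≤ #(B.W n) := by
  have := Fintype.toEncodable α
  -- Writing `m + 1 = 2 ^ N * (2 * t + 1)` makes `m` encode a pair: the bound `b m = N` and the word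
  -- with code `t`. Thus every word is scheduled with every bound; the default `[]` only fills
  -- indices that code no word.
  let b : ℕ → ℕ := fun m => padicValNat 2 (m + 1)
  let e : ℕ → List α := fun m => (Encodable.decode ((m + 1) / 2 ^ b m / 2)).getD []
  choose C hCW hCk hCb hCf hCe using fun m => exists_block_step y (k m) (b m) (e m)
  let W : ℕ → Finset (List α) := fun n =>
    Nat.rec (univ.image fun a => [a]) (fun m V => image₂ (· ++ ·) (C m V) V) n
  have hWs : ∀ n, W (n + 1) = image₂ (· ++ ·) (C n (W n)) (W n) := fun n => rfl
  have hlen : ∀ n, ∀ w ∈ W n, w.length = 2 ^ n := by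
    intro n
    induction n with
    | zero => simp [W]
    | succ n ih =>
      intro w hw
      rw [hWs] at hw
      obtain ⟨c, hc, v, hv, rfl⟩ := mem_image₂.1 hw
      rw [List.length_append, ih _ (hCW _ _ hc), ih _ hv, pow_succ, mul_two]
  have hfree : ∀ n, (Fintype.card α - 1) * ∏ i ∈ range n, k i ≤ #{w ∈ W n | w.count y = 0} := by
    intro n
    induction n with
    | zero =>
      have hinj : Set.InjOn (fun a : α => [a]) ((univ.erase y : Finset α) : Set α) :=
        fun a _ b _ h => by simpa using h
      calc _ = #((univ.erase y).image fun a : α => [a]) := by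
            rw [card_image_of_injOn hinj, card_erase_of_mem (mem_univ _), card_univ]
            simp
        _ ≤ _ := by
            refine card_le_card fun w hw => ?_
            obtain ⟨a, ha, rfl⟩ := mem_image.1 hw
            refine mem_filter.2 ⟨mem_image_of_mem _ (mem_univ _), ?_⟩
            simpa [List.count_singleton] using ne_of_mem_erase ha
    | succ n ih =>
      -- The number of `y`-free words multiplies by at least `k n`, since concatenation is injective
      -- on words of fixed length.
      have hsub : image₂ (· ++ ·) {w ∈ C n (W n) | w.count y = 0} {w ∈ W n | w.count y = 0} ⊆
          {w ∈ W (n + 1) | w.count y = 0} := by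
        intro w hw
        obtain ⟨c, hc, v, hv, rfl⟩ := mem_image₂.1 hw
        rw [mem_filter] at hc hv ⊢
        exact ⟨mem_image₂_of_mem hc.1 hv.1, by rw [List.count_append, hc.2, hv.2]⟩
      refine le_trans ?_ (card_le_card hsub)
      rw [card_image₂_iff.2, prod_range_succ, ← mul_assoc, mul_comm]
      · exact Nat.mul_le_mul (hCf n (W n) ((hk' n).trans ih)) ih
      · intro q h q' h' heq
        have key : ∀ q ∈ (({w ∈ C n (W n) | w.count y = 0} : Finset (List α)) : Set (List α)) ×ˢ
            (({w ∈ W n | w.count y = 0} : Finset (List α)) : Set (List α)),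
            q.1.length = 2 ^ n := fun q hq =>
          hlen n _ (hCW _ _ (mem_filter.1 (mem_coe.1 hq.1)).1)
        have := List.append_inj heq ((key q h).trans (key q' h').symm)
        exact Prod.ext this.1 this.2
  refine ⟨⟨W, fun n => C n (W n), b, rfl, hWs, fun n => hCW n _, fun n => hCb n _,
    sum_padicValNat_two_le, fun n => ?_, fun u N => ?_⟩, fun n => hCk n _,
    fun n => (hfree n).trans (card_le_card (filter_subset _ _))⟩
  · obtain ⟨w, hw⟩ := card_pos.1 ((hk n).trans (hCf n (W n) ((hk' n).trans (hfree n))))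
    exact ⟨w, (mem_filter.1 hw).1, (mem_filter.1 hw).2⟩
  · set t := Encodable.encode u with ht
    have hpos : 0 < 2 ^ N * (2 * t + 1) := by positivity
    set m := 2 ^ N * (2 * t + 1) - 1 with hm
    have hm1 : m + 1 = 2 ^ N * (2 * t + 1) := by omega
    have hb : b m = N := by
      change padicValNat 2 (m + 1) = N
      rw [hm1, padicValNat.mul (by positivity) (by omega), padicValNat.prime_pow,
        padicValNat.eq_zero_of_not_dvd (by omega), add_zero]
    have he : e m = u := by
      change (Encodable.decode ((m + 1) / 2 ^ b m / 2)).getD [] = u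
      rw [hb, hm1, Nat.mul_div_cancel_left _ (by positivity)]
      have : (2 * t + 1) / 2 = t := by omega
      rw [this, ht, Encodable.encodek]
      rfl
    refine ⟨m, ?_, fun v hv huv hvN => ?_⟩
    · have h1 : N < 2 ^ N := Nat.lt_two_pow_self
      have h2 : 2 ^ N ≤ 2 ^ N * (2 * t + 1) := Nat.le_mul_of_pos_right _ (by omega)
      omega
    · have := hCe m (W m) v hv (by rwa [he]) (by rwa [hb])
      rwa [he] at this

/-! ### A language with growth `f`. -/

theorem pow_mul_le_of_mul_le {f : ℕ+ → ℕ+} {C : ℕ+} (hC : ∀ n : ℕ+, n * f n ≤ f (C * n))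
    (k : ℕ) (n : ℕ+) : n ^ k * f n ≤ f (C ^ k * n) := by
  induction k with
  | zero => simp
  | succ k ih =>
    calc n ^ (k + 1) * f n = n * (n ^ k * f n) := by rw [pow_succ']; ring
      _ ≤ (C ^ k * n) * f (C ^ k * n) :=
        mul_le_mul' (PNat.coe_le_coe _ _ |>.1 (by
          push_cast; exact Nat.le_mul_of_pos_left _ (by positivity))) ih
      _ ≤ f (C * (C ^ k * n)) := hC _
      _ = f (C ^ (k + 1) * n) := by rw [pow_succ', mul_assoc]

/-- If `f 1 = 1`, submultiplicativity gives `f ≤ 1` everywhere, against `2 * f 2 ≤ f (C * 2)`. -/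
theorem two_le_apply_one {f : ℕ+ → ℕ+} (hsub : ∀ m n : ℕ+, f (m + n) ≤ f m * f n) {C : ℕ+}
    (hC : ∀ n : ℕ+, n * f n ≤ f (C * n)) : 2 ≤ (f 1 : ℕ) := by
  by_contra! h
  have h1 : f 1 = 1 := PNat.coe_injective (le_antisymm (by simpa using Nat.lt_succ_iff.1 h) (f 1).2)
  have hall : ∀ n, f n ≤ 1 := by
    intro n
    induction n with
    | one => exact h1.le
    | succ n ih => exact (hsub n 1).trans (by simpa [h1] using ih)
  have h2 : (2 : ℕ+) ≤ 1 :=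
    calc (2 : ℕ+) = 2 * 1 := rfl
      _ ≤ 2 * f 2 := mul_le_mul' le_rfl one_le
      _ ≤ f (C * 2) := hC 2
      _ ≤ 1 := hall _
  exact absurd h2 (by decide)

/-- Every function `f` as in the main theorem is, up to equivalence, the growth function of a
hereditary language in which any two words are factors of a third one in the given order, and in
which one letter is logarithmically rare. -/
theorem exists_language (f : ℕ+ → ℕ+) (hmono : Monotone f)
    (hsub : ∀ m n : ℕ+, f (m + n) ≤ f m * f n)
    (hC : ∃ C : ℕ+, ∀ n : ℕ+, n * f n ≤ f (C * n)) :
    ∃ (d : ℕ) (L : Set (List (Fin (d + 1)))),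
      (∀ u v, u <:+: v → v ∈ L → u ∈ L) ∧ [Fin.last d] ∈ L ∧
      (∀ u ∈ L, ∀ v ∈ L, ∃ w, u ++ w ++ v ∈ L) ∧
      (∃ C D : ℕ+, ∀ n : ℕ+, (f n : ℕ) ≤ {w ∈ L | w.length ≤ (C * n : ℕ+)}.ncard ∧
        {w ∈ L | w.length ≤ n}.ncard ≤ f (D * n)) ∧
      ∃ K : ℕ, ∀ w ∈ L, w.count (Fin.last d) ≤ K * (Nat.log 2 w.length + 1) := by
  obtain ⟨C, hC⟩ := hC
  set d : ℕ := (f 1 : ℕ) with hd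
  have hd2 : 2 ≤ d := two_le_apply_one hsub hC
  let p : ℕ → ℕ := fun n => f (2 ^ n)
  let k : ℕ → ℕ := fun n => p (n + 1) ⌈/⌉ p n
  have hp0 : p 0 = d := by simp [p, hd]
  have hp : ∀ n, 0 < p n := fun n => (f _).2
  have hpm : ∀ n, p n ≤ p (n + 1) := fun n => by
    refine (PNat.coe_le_coe _ _).2 (hmono ((PNat.coe_le_coe _ _).1 ?_))
    push_cast
    exact Nat.pow_le_pow_right (by norm_num) n.le_succ
  have hps : ∀ n, p (n + 1) ≤ p n * p n := fun n => by
    have := hsub (2 ^ n) (2 ^ n)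
    rw [show (2 ^ n + 2 ^ n : ℕ+) = 2 ^ (n + 1) from
      PNat.coe_injective (by push_cast; rw [pow_succ, mul_two])] at this
    exact_mod_cast this
  have hk1 : ∀ n, p (n + 1) ≤ p n * k n := fun n => le_smul_ceilDiv (hp n)
  have hkpos : ∀ n, 1 ≤ k n := fun n => by
    by_contra! h
    have := hk1 n
    rw [Nat.lt_one_iff.1 h, mul_zero] at this
    exact absurd (hp (n + 1)) (by omega)
  -- Submultiplicativity enters here: `W n` has enough `y`-free words to fill `C n`.
  have hkle : ∀ n, k n ≤ p n := fun n => (ceilDiv_le_iff_le_smul (hp n)).2 (hps n)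
  have hk2 : ∀ n, k n * p n ≤ 2 * p (n + 1) := fun n => by
    have h1 : k n = (p (n + 1) + p n - 1) / p n := Nat.ceilDiv_eq_add_pred_div ..
    have h2 : k n * p n ≤ p (n + 1) + p n - 1 := by
      rw [h1]; exact Nat.div_mul_le_self _ _
    have := hpm n
    omega
  have hprod : ∀ n, p n ≤ d * ∏ i ∈ Finset.range n, k i := by
    intro n
    induction n with
    | zero => simp [hp0]
    | succ n ih =>
      rw [Finset.prod_range_succ, ← mul_assoc]
      exact (hk1 n).trans (Nat.mul_le_mul_right _ ih)
  obtain ⟨B, hBC, hBW⟩ := exists_blockSystem (Fin.last d) k hkpos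
    (by simpa using fun n => (hkle n).trans (hprod n))
  have hlow : ∀ n, p n ≤ (B.W n).card := fun n => (hprod n).trans (by simpa using hBW n)
  -- Each level loses a factor `4`: `2` from the extra word, as `k n + 1 ≤ 2 * k n`, and `2` from
  -- rounding up in `k n`.
  have hCW : ∀ n, (B.W n).card ≤ 2 * 4 ^ n * p n →
      (B.C n).card * (B.W n).card ≤ 2 * 4 ^ (n + 1) * p (n + 1) := by
    intro n h
    have h1 := hBC n
    have h2 := hkpos n
    calc (B.C n).card * (B.W n).card ≤ (2 * k n) * (2 * 4 ^ n * p n) :=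
          Nat.mul_le_mul (by omega) h
      _ = 4 * 4 ^ n * (k n * p n) := by ring
      _ ≤ 4 * 4 ^ n * (2 * p (n + 1)) := Nat.mul_le_mul_left _ (hk2 n)
      _ = _ := by ring
  have hup : ∀ n, (B.W n).card ≤ 2 * 4 ^ n * p n := by
    intro n
    induction n with
    | zero =>
      rw [B.W_zero, hp0]
      refine Finset.card_image_le.trans ?_
      simp
      omega
    | succ n ih =>
      rw [B.W_succ]
      exact (Finset.card_image₂_le _ _ _).trans (hCW n ih)
  have hclog : ∀ n : ℕ+, (n : ℕ) ≤ 2 ^ Nat.clog 2 n ∧ 2 ^ Nat.clog 2 n ≤ 2 * (n : ℕ) := by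
    intro n
    refine ⟨Nat.le_pow_clog (by norm_num) _, ?_⟩
    rcases eq_or_ne (n : ℕ) 1 with h | h
    · simp [h]
    · have h1 : 1 < (n : ℕ) := by have := n.pos; omega
      have h2 := Nat.pow_pred_clog_lt_self (b := 2) (by norm_num) h1
      have h3 := Nat.clog_pos (b := 2) (by norm_num) h1
      obtain ⟨j, hj⟩ := Nat.exists_eq_succ_of_ne_zero h3.ne'
      rw [hj] at h2 ⊢
      simp only [Nat.pred_succ, Nat.succ_eq_add_one, pow_succ] at h2 ⊢
      omega
  -- `2` comes from `2 ^ clog n ≤ 2 * n`, `C ^ 8` from absorbing an overhead of `M ^ 8`, and `4`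
  -- from `M = 2 ^ (j + 1) ≤ 4 * n`.
  refine ⟨d, B.language, fun u v => B.language_of_infix, B.singleton_mem_language _,
    fun u hu v hv => B.language_prime hu hv, ⟨2, C ^ 8 * 4, fun n => ⟨?_, ?_⟩⟩, 4,
    fun w => B.count_le_log⟩
  · obtain ⟨h1, h2⟩ := hclog n
    calc (f n : ℕ) ≤ p (Nat.clog 2 n) := by
          refine (PNat.coe_le_coe _ _).2 (hmono ((PNat.coe_le_coe _ _).1 ?_))
          push_cast
          exact h1
      _ ≤ _ := (hlow _).trans (B.card_W_le_ncard _ _ (by push_cast; exact h2))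
  · set j := Nat.clog 2 n with hj
    obtain ⟨h1, h2⟩ := hclog n
    rw [← hj] at h1 h2
    let M : ℕ+ := 2 ^ (j + 1)
    have hM : (M : ℕ) = 2 ^ (j + 1) := by simp [M]
    have hM2 : 2 ≤ (M : ℕ) := by
      rw [hM, pow_succ]
      have : 0 < 2 ^ j := by positivity
      omega
    have hnum : 2 * (2 * 4 ^ (j + 1)) * ((M : ℕ) + 1) ^ 2 ≤ (M : ℕ) ^ 8 := by
      have h4 : 4 ^ (j + 1) = (M : ℕ) ^ 2 := by
        rw [hM, ← pow_mul, mul_comm, pow_mul]; norm_num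
      rw [h4]
      have h5 : (M : ℕ) + 1 ≤ 2 * M := by omega
      have h6 : 16 ≤ (M : ℕ) ^ 4 := le_trans (by norm_num) (Nat.pow_le_pow_left hM2 4)
      calc 2 * (2 * (M : ℕ) ^ 2) * ((M : ℕ) + 1) ^ 2 ≤ 2 * (2 * (M : ℕ) ^ 2) * (2 * M) ^ 2 := by
            gcongr
        _ = 16 * (M : ℕ) ^ 4 := by ring
        _ ≤ (M : ℕ) ^ 4 * (M : ℕ) ^ 4 := Nat.mul_le_mul_right _ h6
        _ = (M : ℕ) ^ 8 := by ring
    calc {w ∈ B.language | w.length ≤ n}.ncard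
        ≤ {w ∈ B.language | w.length ≤ 2 ^ j}.ncard :=
          Set.ncard_le_ncard (fun w hw => ⟨hw.1, le_trans hw.2 h1⟩)
            ((List.finite_length_le _ (2 ^ j)).subset fun w hw => hw.2)
      _ ≤ 2 * ((B.C j).card * (B.W j).card) * (2 ^ (j + 1) + 1) ^ 2 := B.ncard_language_le j
      _ ≤ 2 * (2 * 4 ^ (j + 1) * p (j + 1)) * ((M : ℕ) + 1) ^ 2 := by
          rw [hM]
          exact Nat.mul_le_mul_right _ (Nat.mul_le_mul_left _ (hCW j (hup j)))
      _ = 2 * (2 * 4 ^ (j + 1)) * ((M : ℕ) + 1) ^ 2 * f M := by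
          change _ = _ * p (j + 1)
          ring
      _ ≤ (M : ℕ) ^ 8 * f M := Nat.mul_le_mul_right _ hnum
      _ ≤ f (C ^ 8 * M) := by exact_mod_cast pow_mul_le_of_mul_le hC 8 M
      _ ≤ f (C ^ 8 * 4 * n) := by
          refine (PNat.coe_le_coe _ _).2 (hmono ?_)
          rw [mul_assoc]
          refine mul_le_mul' le_rfl ((PNat.coe_le_coe _ _).1 ?_)
          rw [hM, pow_succ]
          push_cast
          omega

/-! ### Word bases and primeness of monomial algebras. -/

namespace MonomialAlgebra

variable {F : Type*} [Field F] {X : Type*} {S : Set (FreeMonoid X)}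

theorem equivMonoidAlgebraFreeMonoid_wordMonomial (w : FreeMonoid X) :
    FreeAlgebra.equivMonoidAlgebraFreeMonoid (wordMonomial F w) = MonoidAlgebra.single w 1 := by
  rw [← AlgEquiv.eq_symm_apply]
  simp [FreeAlgebra.equivMonoidAlgebraFreeMonoid, wordMonomial]

theorem eq_sum_wordMonomial (a : FreeAlgebra F X) :
    a = (FreeAlgebra.equivMonoidAlgebraFreeMonoid a).coeff.sum
      fun w c => c • wordMonomial F w := by
  apply FreeAlgebra.equivMonoidAlgebraFreeMonoid.injective
  rw [Finsupp.sum, map_sum]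
  simp only [map_smul, equivMonoidAlgebraFreeMonoid_wordMonomial, MonoidAlgebra.smul_single,
    smul_eq_mul, mul_one]
  exact (MonoidAlgebra.sum_coeff_single _).symm

/-- For a set `S` of words closed under multiplication by arbitrary words, the monomial ideal of
`S` consists of the elements supported in `S`. -/
theorem mem_monomialIdeal_iff (hS : ∀ u v w : FreeMonoid X, v ∈ S → u * v * w ∈ S)
    {a : FreeAlgebra F X} : a ∈ monomialIdeal F S ↔
      ∀ w ∈ (FreeAlgebra.equivMonoidAlgebraFreeMonoid a).coeff.support, w ∈ S := by
  classical
  constructor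
  · let J : TwoSidedIdeal (FreeAlgebra F X) := .mk'
      {a | ∀ w ∈ (FreeAlgebra.equivMonoidAlgebraFreeMonoid a).coeff.support, w ∈ S}
      (by simp)
      (by
        intro x y hx hy w hw
        rw [map_add, MonoidAlgebra.coeff_add] at hw
        rcases Finset.mem_union.1 (Finsupp.support_add hw) with h | h
        exacts [hx w h, hy w h])
      (by
        intro x hx w hw
        rw [map_neg, MonoidAlgebra.coeff_neg, Finsupp.support_neg] at hw
        exact hx w hw)
      (by
        intro x y hy w hw
        rw [map_mul] at hw
        obtain ⟨u, -, v, hv, rfl⟩ :=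
          Finset.mem_mul.1 (MonoidAlgebra.support_coeff_mul_subset _ _ hw)
        simpa using hS u v 1 (hy v hv))
      (by
        intro x y hx w hw
        rw [map_mul] at hw
        obtain ⟨u, hu, v, -, rfl⟩ :=
          Finset.mem_mul.1 (MonoidAlgebra.support_coeff_mul_subset _ _ hw)
        simpa using hS 1 u v (hx u hu))
    suffices h : monomialIdeal F S ≤ J from fun ha => (TwoSidedIdeal.mem_mk' ..).1 (h ha)
    refine TwoSidedIdeal.span_le.2 ?_
    rintro _ ⟨w, hw, rfl⟩
    refine (TwoSidedIdeal.mem_mk' ..).2 fun v hv => ?_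
    rw [equivMonoidAlgebraFreeMonoid_wordMonomial, MonoidAlgebra.coeff_single] at hv
    rw [Finset.mem_singleton.1 (Finsupp.support_single_subset hv)]
    exact hw
  · intro h
    rw [eq_sum_wordMonomial a]
    refine sum_mem fun w hw => ?_
    beta_reduce
    rw [Algebra.smul_def]
    exact TwoSidedIdeal.mul_mem_left _ _ _ (TwoSidedIdeal.subset_span ⟨w, h w hw, rfl⟩)

theorem word_mul (u v : FreeMonoid X) : word F S (u * v) = word F S u * word F S v := by
  simp [word, wordMonomial]

theorem word_one : word F S 1 = 1 := by simp [word, wordMonomial]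

theorem mk_eq_zero_iff {a : FreeAlgebra F X} :
    (monomialIdeal F S).ringCon.mk' a = 0 ↔ a ∈ monomialIdeal F S := by
  rw [← TwoSidedIdeal.mem_ker, TwoSidedIdeal.ker_ringCon_mk']

theorem word_eq_zero {w : FreeMonoid X} (hw : w ∈ S) : word F S w = 0 :=
  mk_eq_zero_iff.2 (TwoSidedIdeal.subset_span ⟨w, hw, rfl⟩)

/-- A vanishing combination lifts to an element of the ideal, hence is supported in `S`; but its
words avoid `S`. -/
theorem linearIndependent_word (hS : ∀ u v w : FreeMonoid X, v ∈ S → u * v * w ∈ S) :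
    LinearIndependent F fun w : {w // w ∉ S} => word F S w := by
  rw [linearIndependent_iff]
  intro c hc
  have h1 : Finsupp.linearCombination F (fun w : {w // w ∉ S} => word F S w) c =
      (monomialIdeal F S).ringCon.mkₐ (α := F)
        (FreeAlgebra.equivMonoidAlgebraFreeMonoid.symm (.ofCoeff (c.mapDomain (↑)))) := by
    rw [Finsupp.linearCombination_apply, Finsupp.sum, eq_sum_wordMonomial
      (FreeAlgebra.equivMonoidAlgebraFreeMonoid.symm _), AlgEquiv.apply_symm_apply,
      MonoidAlgebra.coeff_ofCoeff, Finsupp.sum_mapDomain_index (by simp) (by simp [add_smul]),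
      Finsupp.sum, map_sum]
    simp [word]
  rw [h1] at hc
  have h2 := (mem_monomialIdeal_iff hS).1 (mk_eq_zero_iff.1 hc)
  rw [AlgEquiv.apply_symm_apply, MonoidAlgebra.coeff_ofCoeff] at h2
  ext ⟨w, hw⟩
  by_contra hne
  refine hw (h2 w (Finsupp.mem_support_iff.2 ?_))
  rwa [← Finsupp.mapDomain_apply Subtype.val_injective c ⟨w, hw⟩] at hne

theorem span_range_word : Submodule.span F (Set.range (word F S)) = ⊤ := by
  refine eq_top_iff.2 fun b _ => ?_
  obtain ⟨a, rfl⟩ := (monomialIdeal F S).ringCon.mkₐ_surjective (α := F) b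
  rw [eq_sum_wordMonomial a, Finsupp.sum, map_sum]
  refine sum_mem fun w _ => ?_
  rw [map_smul]
  exact Submodule.smul_mem _ _ (Submodule.subset_span ⟨w, rfl⟩)

/-- The words outside `S` form a basis of the monomial algebra. -/
noncomputable def wordBasis (hS : ∀ u v w : FreeMonoid X, v ∈ S → u * v * w ∈ S) :
    Module.Basis {w // w ∉ S} F (MonomialAlgebra F S) :=
  .mk (linearIndependent_word hS) (by
    rw [← span_range_word, Submodule.span_le]
    rintro _ ⟨w, rfl⟩
    by_cases hw : w ∈ S
    · rw [word_eq_zero hw]; exact zero_mem _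
    · exact Submodule.subset_span ⟨⟨w, hw⟩, rfl⟩)

theorem wordBasis_apply (hS : ∀ u v w : FreeMonoid X, v ∈ S → u * v * w ∈ S) (w : {w // w ∉ S}) :
    wordBasis (F := F) hS w = word F S w := by
  simp [wordBasis]

theorem word_ne_zero_iff (hS : ∀ u v w : FreeMonoid X, v ∈ S → u * v * w ∈ S)
    {w : FreeMonoid X} : word F S w ≠ 0 ↔ w ∉ S := by
  refine ⟨fun h hw => h (word_eq_zero hw), fun hw => ?_⟩
  simpa [wordBasis_apply] using (wordBasis (F := F) hS).ne_zero ⟨w, hw⟩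

theorem coord_word (hS : ∀ u v w : FreeMonoid X, v ∈ S → u * v * w ∈ S) (z : {w // w ∉ S})
    {w : FreeMonoid X} (hw : w ≠ z) : (wordBasis (F := F) hS).coord z (word F S w) = 0 := by
  by_cases h : w ∈ S
  · rw [word_eq_zero h, map_zero]
  · rw [← wordBasis_apply hS ⟨w, h⟩, Module.Basis.coord_apply, Module.Basis.repr_self,
      Finsupp.single_eq_of_ne]
    exact fun h' => hw (congrArg Subtype.val h').symm

theorem eq_sum_word (hS : ∀ u v w : FreeMonoid X, v ∈ S → u * v * w ∈ S)
    (a : MonomialAlgebra F S) :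
    a = ∑ u ∈ ((wordBasis hS).repr a).support, (wordBasis hS).repr a u • word F S u := by
  conv_lhs => rw [← (wordBasis hS).linearCombination_repr a]
  simp [Finsupp.linearCombination_apply, Finsupp.sum, wordBasis_apply]

/-- A monomial algebra is prime if any two nonzero words can be joined to a nonzero word. -/
theorem isPrimeRing (hS : ∀ u v w : FreeMonoid X, v ∈ S → u * v * w ∈ S) (h1 : 1 ∉ S)
    (hp : ∀ u ∉ S, ∀ v ∉ S, ∃ w, u * w * v ∉ S) : IsPrimeRing (MonomialAlgebra F S) := by
  refine ⟨⟨1, 0, by rw [← word_one]; exact (word_ne_zero_iff hS).2 h1⟩, fun a b hab => ?_⟩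
  by_contra! hne
  have hsupp : ∀ x : MonomialAlgebra F S, x ≠ 0 → ((wordBasis hS).repr x).support.Nonempty :=
    fun x hx => Finsupp.support_nonempty_iff.2 (by simpa using hx)
  obtain ⟨u, hu, humax⟩ := Finset.exists_max_image _
    (fun w : {w // w ∉ S} => w.1.length) (hsupp a hne.1)
  obtain ⟨v, hv, hvmax⟩ := Finset.exists_max_image _
    (fun w : {w // w ∉ S} => w.1.length) (hsupp b hne.2)
  obtain ⟨w, hw⟩ := hp u u.2 v v.2
  -- With `u` and `v` of maximal length in the supports, the word `u * w * v` arises in `a * w * b`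
  -- only from `u` and `v`, so its coefficient is a product of two nonzero scalars.
  have key : ∀ u' ∈ ((wordBasis hS).repr a).support, ∀ v' ∈ ((wordBasis hS).repr b).support,
      (u' : FreeMonoid X) * w * v' = u * w * v → u' = u ∧ v' = v := by
    intro u' hu' v' hv' h
    have hlen := congrArg FreeMonoid.length h
    simp only [FreeMonoid.length_mul] at hlen
    have h3 := humax u' hu'
    have h4 := hvmax v' hv'
    have h5 : (u' : FreeMonoid X).toList ++ (w.toList ++ (v' : FreeMonoid X).toList) =
        (u : FreeMonoid X).toList ++ (w.toList ++ (v : FreeMonoid X).toList) := by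
      simpa [mul_assoc] using congrArg FreeMonoid.toList h
    obtain ⟨h6, h7⟩ := List.append_inj h5 (show u'.1.length = u.1.length by omega)
    exact ⟨Subtype.ext h6, Subtype.ext (List.append_cancel_left h7)⟩
  have h0 := congrArg ((wordBasis hS).coord ⟨_, hw⟩) (hab (word F S w))
  rw [map_zero, eq_sum_word hS a, eq_sum_word hS b, Finset.sum_mul, Finset.sum_mul_sum,
    map_sum] at h0
  rw [Finset.sum_eq_single_of_mem u hu, map_sum, Finset.sum_eq_single_of_mem v hv] at h0
  · rw [smul_mul_assoc, smul_mul_smul_comm, ← word_mul, ← word_mul, map_smul,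
      ← wordBasis_apply hS ⟨_, hw⟩, Module.Basis.coord_apply, Module.Basis.repr_self,
      Finsupp.single_eq_same, smul_eq_mul, mul_one] at h0
    exact mul_ne_zero (Finsupp.mem_support_iff.1 hu) (Finsupp.mem_support_iff.1 hv) h0
  · intro v' hv' hne'
    rw [smul_mul_assoc, smul_mul_smul_comm, ← word_mul, ← word_mul, map_smul, coord_word hS,
      smul_zero]
    exact fun h => hne' (key u hu v' hv' h).2
  · intro u' hu' hne'
    rw [map_sum]
    refine Finset.sum_eq_zero fun v' hv' => ?_
    rw [smul_mul_assoc, smul_mul_smul_comm, ← word_mul, ← word_mul, map_smul, coord_word hS,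
      smul_zero]
    exact fun h => hne' (key u' hu' v' hv' h).1

end MonomialAlgebra

/-- For `l = log (m * k)`, failure gives `2 ^ l ≤ m * K * (l + 1)`. Comparing with `2 ^ (l / 2)`
bounds `l`, hence `k`. -/
theorem exists_forall_mul_log_lt (m K : ℕ) :
    ∃ N : ℕ, ∀ k ≥ N, K * (Nat.log 2 (m * k) + 1) < k := by
  refine ⟨K * (4 * (m * K) + 2) + 1, fun k hk => ?_⟩
  by_contra! h
  set l := Nat.log 2 (m * k) with hl
  suffices hle : l ≤ 4 * (m * K) + 1 by
    have := Nat.mul_le_mul_left K (show l + 1 ≤ 4 * (m * K) + 2 by omega)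
    omega
  rcases eq_or_ne (m * k) 0 with h0 | h0
  · simp [hl, h0]
  have h1 : 2 ^ l ≤ m * K * (l + 1) :=
    (Nat.pow_log_le_self 2 h0).trans (by rw [mul_assoc]; exact Nat.mul_le_mul_left m h)
  have h2 : l / 2 + 1 ≤ 2 ^ (l / 2) := Nat.lt_two_pow_self
  have h3 : 2 ^ (l / 2) * 2 ^ (l / 2) ≤ 2 ^ l := by
    rw [← pow_add]
    exact Nat.pow_le_pow_right (by norm_num) (by omega)
  have h4 : 2 ^ (l / 2) * 2 ^ (l / 2) ≤ 2 * (m * K) * 2 ^ (l / 2) :=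
    calc _ ≤ m * K * (l + 1) := h3.trans h1
      _ ≤ m * K * (2 * 2 ^ (l / 2)) := Nat.mul_le_mul_left _ (by omega)
      _ = _ := by ring
  have h5 := Nat.le_of_mul_le_mul_right h4 (by positivity)
  omega

/-! ### Independence of growth type from the generating subspace. -/

section Growth

variable {F : Type*} [Field F] {A : Type*} [Ring A] [Algebra F A]

/-- As powers of `1 ⊔ V`, growth functions can be compared through an inclusion `U ≤ (1 ⊔ V) ^ k`.
-/
theorem growthFunction_eq_finrank_pow (V : Submodule F A) (n : ℕ) :
    growthFunction F V n = Module.finrank F ((1 ⊔ V) ^ n : Submodule F A) := by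
  have h : (⨆ i ∈ Finset.range (n + 1), V ^ i) = (1 ⊔ V) ^ n := by
    apply le_antisymm
    · refine iSup₂_le fun i hi => ?_
      calc V ^ i ≤ (1 ⊔ V) ^ i := pow_le_pow_left' le_sup_right i
        _ ≤ (1 ⊔ V) ^ n := pow_le_pow_right' le_sup_left (by simpa [Nat.lt_succ_iff] using hi)
    · induction n with
      | zero => simp
      | succ n ih =>
        rw [pow_succ]
        refine (mul_le_mul' ih le_rfl).trans ?_
        simp only [Submodule.iSup_mul, Submodule.mul_sup, mul_one, ← pow_succ]
        refine sup_le (iSup₂_le fun i hi => ?_) (iSup₂_le fun i hi => ?_)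
        · exact le_iSup₂_of_le i (by simp at hi ⊢; omega) le_rfl
        · exact le_iSup₂_of_le (i + 1) (by simp at hi ⊢; omega) le_rfl
  rw [growthFunction, h]

theorem exists_le_pow_of_adjoin_eq_top {V U : Submodule F A}
    (hV : Algebra.adjoin F (V : Set A) = ⊤) (hU : U.FG) : ∃ k : ℕ, U ≤ (1 ⊔ V) ^ k := by
  have hmono : ∀ {i j : ℕ}, i ≤ j → (1 ⊔ V) ^ i ≤ (1 ⊔ V) ^ j := fun h =>
    pow_le_pow_right' le_sup_left h
  have hel : ∀ a : A, ∃ k : ℕ, a ∈ (1 ⊔ V) ^ k := by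
    intro a
    have ha : a ∈ Algebra.adjoin F (V : Set A) := hV ▸ Algebra.mem_top
    induction ha using Algebra.adjoin_induction with
    | mem x hx => exact ⟨1, by rw [pow_one]; exact Submodule.mem_sup_right hx⟩
    | algebraMap r => exact ⟨0, by rw [pow_zero]; exact Submodule.algebraMap_mem r⟩
    | add x y _ _ hx hy =>
      obtain ⟨i, hi⟩ := hx
      obtain ⟨j, hj⟩ := hy
      exact ⟨max i j, add_mem (hmono (le_max_left i j) hi) (hmono (le_max_right i j) hj)⟩
    | mul x y _ _ hx hy =>
      obtain ⟨i, hi⟩ := hx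
      obtain ⟨j, hj⟩ := hy
      exact ⟨i + j, by rw [pow_add]; exact Submodule.mul_mem_mul hi hj⟩
  choose k hk using hel
  obtain ⟨s, rfl⟩ := hU
  exact ⟨s.sup k, Submodule.span_le.2 fun a ha => hmono (Finset.le_sup ha) (hk a)⟩

theorem growthFunction_le_of_le_pow {U V : Submodule F A} (hV : V.FG) {k : ℕ}
    (h : U ≤ (1 ⊔ V) ^ k) (n : ℕ) : growthFunction F U n ≤ growthFunction F V (k * n) := by
  rw [growthFunction_eq_finrank_pow, growthFunction_eq_finrank_pow, pow_mul]
  have hfg : (((1 ⊔ V) ^ k) ^ n : Submodule F A).FG :=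
    (((Submodule.FG.sup ⟨{1}, by simp [Submodule.one_eq_span]⟩ hV).pow k).pow n)
  have := Module.Finite.of_fg hfg
  exact Submodule.finrank_mono (pow_le_pow_left' (sup_le (one_le_pow_of_one_le' le_sup_left k) h) n)

/-- The growth type may be computed on one finite-dimensional generating subspace. -/
theorem hasGrowthType_of_generating {f : ℕ+ → ℕ+} {U : Submodule F A} (hU : U.FG)
    (hgen : Algebra.adjoin F (U : Set A) = ⊤)
    (h : ∃ C D : ℕ+, ∀ n : ℕ+, (f n : ℕ) ≤ growthFunction F U (C * n : ℕ+) ∧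
      growthFunction F U n ≤ f (D * n)) : HasGrowthType F A f := by
  constructor
  · obtain ⟨s, rfl⟩ := hU
    exact ⟨s, by rwa [Algebra.adjoin_span] at hgen⟩
  · intro V hV hVgen
    obtain ⟨C, D, h⟩ := h
    obtain ⟨k, hk⟩ := exists_le_pow_of_adjoin_eq_top hVgen hU
    obtain ⟨l, hl⟩ := exists_le_pow_of_adjoin_eq_top hgen hV
    -- The exponents are raised by one because the constants of `GrowthEquiv` must be positive.
    have hk' : U ≤ (1 ⊔ V) ^ (k + 1) := hk.trans (pow_le_pow_right' le_sup_left k.le_succ)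
    have hl' : V ≤ (1 ⊔ U) ^ (l + 1) := hl.trans (pow_le_pow_right' le_sup_left l.le_succ)
    refine ⟨k.succPNat * C, D * (l.succPNat * (k.succPNat * C)), fun n => ⟨?_, ?_⟩⟩
    · rw [mul_assoc]
      exact (h n).1.trans (growthFunction_le_of_le_pow hV hk' _)
    · refine (growthFunction_le_of_le_pow hU hl' _).trans ?_
      rw [mul_assoc D, mul_assoc l.succPNat]
      exact (h (l.succPNat * (k.succPNat * C * n))).2

end Growth

/-! ### Growth of monomial algebras. -/

namespace MonomialAlgebra

open scoped Pointwise

variable {F : Type*} [Field F] {X : Type*} {S : Set (FreeMonoid X)}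

/-- The span of the letters in a monomial algebra. -/
noncomputable def letterSpan (F : Type*) [Field F] {X : Type*} (S : Set (FreeMonoid X)) :
    Submodule F (MonomialAlgebra F S) :=
  Submodule.span F (Set.range fun x => word F S (FreeMonoid.of x))

theorem letterSpan_fg [Finite X] : (letterSpan F S).FG :=
  Submodule.fg_span (Set.finite_range _)

theorem word_mem_adjoin (w : FreeMonoid X) :
    word F S w ∈ Algebra.adjoin F (letterSpan F S : Set (MonomialAlgebra F S)) := by
  induction w using FreeMonoid.inductionOn' with
  | one => rw [word_one]; exact one_mem _
  | of_mul x w ih =>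
    rw [word_mul]
    exact mul_mem (Algebra.subset_adjoin (Submodule.subset_span ⟨x, rfl⟩)) ih

theorem adjoin_letterSpan :
    Algebra.adjoin F (letterSpan F S : Set (MonomialAlgebra F S)) = ⊤ := by
  refine eq_top_iff.2 fun b _ => ?_
  have hb : b ∈ Submodule.span F (Set.range (word F S)) := by
    rw [span_range_word]; exact Submodule.mem_top
  refine (Submodule.span_le (p := Subalgebra.toSubmodule
    (Algebra.adjoin F (letterSpan F S : Set (MonomialAlgebra F S))))).2 ?_ hb
  rintro _ ⟨w, rfl⟩
  exact word_mem_adjoin w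

theorem one_sup_letterSpan_pow (n : ℕ) :
    (1 ⊔ letterSpan F S) ^ n = Submodule.span F (word F S '' {w | w.length ≤ n}) := by
  have h1 : (1 ⊔ letterSpan F S) ≤ Submodule.span F (word F S '' {w | w.length ≤ 1}) := by
    refine sup_le (Submodule.one_le.2 (Submodule.subset_span ⟨1, by simp, word_one⟩))
      (Submodule.span_mono ?_)
    rintro _ ⟨x, rfl⟩
    exact ⟨_, by simp, rfl⟩
  apply le_antisymm
  · induction n with
    | zero =>
      rw [pow_zero]
      exact Submodule.one_le.2 (Submodule.subset_span ⟨1, by simp, word_one⟩)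
    | succ n ih =>
      rw [pow_succ]
      refine (mul_le_mul' ih h1).trans ?_
      rw [Submodule.span_mul_span, Submodule.span_le]
      rintro _ ⟨_, ⟨u, hu, rfl⟩, _, ⟨v, hv, rfl⟩, rfl⟩
      refine Submodule.subset_span ⟨u * v, ?_, word_mul u v⟩
      simp only [Set.mem_ofPred_eq, FreeMonoid.length_mul] at *
      omega
  · rw [Submodule.span_le]
    rintro _ ⟨w, hw, rfl⟩
    induction w using FreeMonoid.inductionOn' generalizing n with
    | one =>
      rw [word_one]
      exact Submodule.one_le.1 (one_le_pow_of_one_le' le_sup_left n)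
    | of_mul x w ih =>
      simp only [Set.mem_ofPred_eq, FreeMonoid.length_mul, FreeMonoid.length_of] at hw
      obtain ⟨m, rfl⟩ := Nat.exists_eq_add_of_le hw
      rw [word_mul, show 1 + w.length + m = 1 + (w.length + m) by ring, pow_add, pow_one]
      exact Submodule.mul_mem_mul
        (Submodule.mem_sup_right (Submodule.subset_span ⟨x, rfl⟩)) (ih _ (by simp))

/-- The growth function of a monomial algebra counts its nonzero words. -/
theorem growthFunction_letterSpan (hS : ∀ u v w : FreeMonoid X, v ∈ S → u * v * w ∈ S) (n : ℕ) :
    growthFunction F (letterSpan F S) n = {w | w ∉ S ∧ w.length ≤ n}.ncard := by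
  rw [growthFunction_eq_finrank_pow, one_sup_letterSpan_pow]
  have hspan : Submodule.span F (word F S '' {w | w.length ≤ n}) =
      Submodule.span F (Set.range fun w : {w | w ∉ S ∧ w.length ≤ n} => word F S w) := by
    apply le_antisymm
    · rw [Submodule.span_le]
      rintro _ ⟨w, hw, rfl⟩
      by_cases h : w ∈ S
      · rw [word_eq_zero h]; exact zero_mem _
      · exact Submodule.subset_span ⟨⟨w, h, hw⟩, rfl⟩
    · refine Submodule.span_mono ?_
      rintro _ ⟨w, rfl⟩
      exact ⟨w, w.2.2, rfl⟩
  have hli : LinearIndependent F fun w : {w | w ∉ S ∧ w.length ≤ n} => word F S w :=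
    (linearIndependent_word hS).comp
      (fun w : {w | w ∉ S ∧ w.length ≤ n} => (⟨w.1, w.2.1⟩ : {w // w ∉ S}))
      fun u v h => Subtype.ext (congrArg (fun w : {w // w ∉ S} => w.1) h)
  rw [hspan, Module.finrank, rank_span hli]
  exact (Nat.card_range_of_injective hli.injective).trans (Nat.card_coe_set_eq _)

/-! ### Local nilpotency from rarity of a letter. -/

section Nilpotent

variable [DecidableEq X]

/-- The span of the words of length at most `m * k` in which the letter `y` occurs `k` times, for
some `k ≥ r`. -/
noncomputable def richSpan (F : Type*) [Field F] {X : Type*} [DecidableEq X]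
    (S : Set (FreeMonoid X)) (y : X) (m r : ℕ) : Submodule F (MonomialAlgebra F S) :=
  Submodule.span F
    (word F S '' {w | r ≤ w.toList.count y ∧ w.length ≤ m * w.toList.count y})

theorem richSpan_mono (y : X) {m m' : ℕ} (h : m ≤ m') (r : ℕ) :
    richSpan F S y m r ≤ richSpan F S y m' r :=
  Submodule.span_mono (Set.image_mono fun _ hw =>
    ⟨hw.1, hw.2.trans (Nat.mul_le_mul_right _ h)⟩)

theorem richSpan_anti (y : X) (m : ℕ) {r r' : ℕ} (h : r ≤ r') :
    richSpan F S y m r' ≤ richSpan F S y m r :=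
  Submodule.span_mono (Set.image_mono fun _ hw => ⟨h.trans hw.1, hw.2⟩)

/-- Length and `y`-count are both additive, so the ratio `m` survives products while the minimal
`y`-count grows. -/
theorem richSpan_mul_le (y : X) (m r r' : ℕ) :
    richSpan F S y m r * richSpan F S y m r' ≤ richSpan F S y m (r + r') := by
  rw [richSpan, richSpan, Submodule.span_mul_span, Submodule.span_le]
  rintro _ ⟨_, ⟨u, hu, rfl⟩, _, ⟨v, hv, rfl⟩, rfl⟩
  refine Submodule.subset_span ⟨u * v, ?_, word_mul u v⟩
  simp only [Set.mem_ofPred_eq, FreeMonoid.length_mul, FreeMonoid.toList_mul, List.count_append,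
    mul_add] at *
  omega

theorem exists_mem_richSpan {y : X} {b : MonomialAlgebra F S}
    (hb : b ∈ TwoSidedIdeal.span {word F S (FreeMonoid.of y)}) : ∃ m, b ∈ richSpan F S y m 1 := by
  have hadd : ∀ a b : MonomialAlgebra F S, (∃ m, a ∈ richSpan F S y m 1) →
      (∃ m, b ∈ richSpan F S y m 1) → ∃ m, a + b ∈ richSpan F S y m 1 := by
    rintro a b ⟨i, hi⟩ ⟨j, hj⟩
    exact ⟨max i j, add_mem (richSpan_mono y (le_max_left i j) 1 hi)
      (richSpan_mono y (le_max_right i j) 1 hj)⟩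
  have hspan : ∀ a : MonomialAlgebra F S, a ∈ Submodule.span F (Set.range (word F S)) :=
    fun a => by rw [span_range_word]; exact Submodule.mem_top
  rw [TwoSidedIdeal.mem_span_iff_mem_addSubgroup_closure] at hb
  induction hb using AddSubgroup.closure_induction with
  | zero => exact ⟨0, zero_mem _⟩
  | add a b _ _ ha hb => exact hadd a b ha hb
  | neg a _ ha =>
    obtain ⟨m, hm⟩ := ha
    exact ⟨m, neg_mem hm⟩
  | mem x hx =>
    obtain ⟨_, ⟨a, -, _, rfl, rfl⟩, c, -, rfl⟩ := hx
    dsimp only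
    induction hspan a using Submodule.span_induction with
    | zero => exact ⟨0, by simp⟩
    | add a b _ _ ha hb => simp only [add_mul]; exact hadd _ _ ha hb
    | smul t a _ ha =>
      obtain ⟨m, hm⟩ := ha
      exact ⟨m, by simpa only [smul_mul_assoc] using Submodule.smul_mem _ t hm⟩
    | mem a ha =>
      obtain ⟨u, rfl⟩ := ha
      induction hspan c using Submodule.span_induction with
      | zero => exact ⟨0, by simp⟩
      | add a b _ _ ha hb => simp only [mul_add]; exact hadd _ _ ha hb
      | smul t a _ ha =>
        obtain ⟨m, hm⟩ := ha
        exact ⟨m, by simpa only [mul_smul_comm] using Submodule.smul_mem _ t hm⟩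
      | mem c hc =>
        obtain ⟨v, rfl⟩ := hc
        rw [← word_mul, ← word_mul]
        have hcount : 1 ≤ (u * FreeMonoid.of y * v).toList.count y := by
          simp [FreeMonoid.toList_mul, FreeMonoid.toList_of, List.count_append]
          omega
        exact ⟨(u * FreeMonoid.of y * v).length,
          Submodule.subset_span ⟨_, ⟨hcount, Nat.le_mul_of_pos_right _ hcount⟩, rfl⟩⟩

/-- In a monomial algebra with logarithmically few occurrences of the letter `y` in nonzero words,
the ideal generated by `y` is locally nilpotent. -/
theorem isLocallyNilpotentIdeal_span (y : X) (K : ℕ)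
    (hK : ∀ w : FreeMonoid X, word F S w ≠ 0 →
      w.toList.count y ≤ K * (Nat.log 2 w.length + 1)) :
    IsLocallyNilpotentIdeal F (TwoSidedIdeal.span {word F S (FreeMonoid.of y)}) := by
  intro s hs
  obtain ⟨m, hm⟩ : ∃ m, ∀ x ∈ s, x ∈ richSpan F S y m 1 := by
    choose! k hk using fun x hx => exists_mem_richSpan (hs x hx)
    exact ⟨s.sup k, fun x hx => richSpan_mono y (Finset.le_sup hx) 1 (hk x hx)⟩
  have hadj : ∀ x ∈ NonUnitalAlgebra.adjoin F (s : Set (MonomialAlgebra F S)),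
      x ∈ richSpan F S y m 1 := by
    intro x hx
    induction hx using NonUnitalAlgebra.adjoin_induction with
    | mem x hx => exact hm x hx
    | add x y _ _ hx hy => exact add_mem hx hy
    | zero => exact zero_mem _
    | mul x z _ _ hx hz =>
      exact richSpan_anti y m (by norm_num)
        (richSpan_mul_le y m 1 1 (Submodule.mul_mem_mul hx hz))
    | smul t x _ hx => exact Submodule.smul_mem _ t hx
  have hprod : ∀ l : List (MonomialAlgebra F S),
      (∀ x ∈ l, x ∈ NonUnitalAlgebra.adjoin F (s : Set (MonomialAlgebra F S))) →
      l.prod ∈ richSpan F S y m l.length := by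
    intro l
    induction l with
    | nil =>
      intro _
      exact Submodule.subset_span ⟨1, by simp, word_one⟩
    | cons x l ih =>
      intro h
      rw [List.prod_cons, List.length_cons, add_comm]
      exact richSpan_mul_le y m 1 _ (Submodule.mul_mem_mul (hadj x (h x (by simp)))
        (ih fun z hz => h z (by simp [hz])))
  obtain ⟨N, hN⟩ := exists_forall_mul_log_lt m K
  refine ⟨N + 1, by omega, fun l hl hmem => ?_⟩
  have h := hprod l hmem
  rw [hl] at h
  suffices h0 : richSpan F S y m (N + 1) ≤ ⊥ from (Submodule.mem_bot F).1 (h0 h)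
  refine Submodule.span_le.2 ?_
  rintro _ ⟨w, ⟨hw1, hw2⟩, rfl⟩
  by_contra hne
  have h1 := hK w hne
  have h2 := hN (w.toList.count y) (by omega)
  have h3 := Nat.mul_le_mul_left K
    (Nat.add_le_add_right (Nat.log_mono_right (b := 2) hw2) 1)
  omega

end Nilpotent

end MonomialAlgebra

/-! ### The main theorem. -/

theorem theorem1p4 (F : Type*) [Field F] (f : ℕ+ → ℕ+) (hmono : Monotone f)
    (hsub : ∀ m n : ℕ+, f (m + n) ≤ f m * f n)
    (hC : ∃ C : ℕ+, ∀ n : ℕ+, n * f n ≤ f (C * n)) :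
    ∃ (d : ℕ) (S : Set (FreeMonoid (Fin (d + 1)))),
      IsPrimeRing (MonomialAlgebra F S) ∧
      HasGrowthType F (MonomialAlgebra F S) f ∧
      (∃ I : TwoSidedIdeal (MonomialAlgebra F S),
        I = TwoSidedIdeal.span {MonomialAlgebra.word F S (FreeMonoid.of (Fin.last d))} ∧
        I ≠ ⊥ ∧ IsLocallyNilpotentIdeal F I) ∧
      ∃ K : ℕ, ∀ w : FreeMonoid (Fin (d + 1)), MonomialAlgebra.word F S w ≠ 0 →
        w.toList.count (Fin.last d) ≤ K * (Nat.log 2 w.length + 1) := by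
  obtain ⟨d, L, hL, hy, hp, hgrowth, K, hK⟩ := exists_language f hmono hsub hC
  -- All words outside `L` are relations; as `L` is closed under factors, `S` is closed under
  -- multiplication by words.
  let S : Set (FreeMonoid (Fin (d + 1))) := {w | w.toList ∉ L}
  have hmem : ∀ {w : FreeMonoid (Fin (d + 1))}, w ∉ S ↔ w.toList ∈ L := fun {w} => not_not
  have hS : ∀ u v w : FreeMonoid (Fin (d + 1)), v ∈ S → u * v * w ∈ S := fun u v w hv h =>
    hv (hL _ _ ⟨u.toList, w.toList, by simp⟩ h)
  have hword : ∀ {w : FreeMonoid (Fin (d + 1))}, MonomialAlgebra.word F S w ≠ 0 ↔ w.toList ∈ L :=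
    fun {w} => (MonomialAlgebra.word_ne_zero_iff hS).trans hmem
  have hlog : ∀ w : FreeMonoid (Fin (d + 1)), MonomialAlgebra.word F S w ≠ 0 →
      w.toList.count (Fin.last d) ≤ K * (Nat.log 2 w.length + 1) :=
    fun w hw => hK _ (hword.1 hw)
  refine ⟨d, S, ?_, ?_, ⟨_, rfl, ?_, MonomialAlgebra.isLocallyNilpotentIdeal_span _ K hlog⟩,
    K, hlog⟩
  · refine MonomialAlgebra.isPrimeRing hS
      (hmem.2 (hL _ _ (List.nil_infix) hy)) fun u hu v hv => ?_
    obtain ⟨w, hw⟩ := hp _ (hmem.1 hu) _ (hmem.1 hv)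
    exact ⟨.ofList w, hmem.2 (by simpa using hw)⟩
  · refine hasGrowthType_of_generating MonomialAlgebra.letterSpan_fg
      MonomialAlgebra.adjoin_letterSpan ?_
    obtain ⟨C, D, h⟩ := hgrowth
    have hcard : ∀ n : ℕ, growthFunction F (MonomialAlgebra.letterSpan F S) n =
        {w ∈ L | w.length ≤ n}.ncard := fun n => by
      rw [MonomialAlgebra.growthFunction_letterSpan hS]
      simp only [hmem]
      rfl
    exact ⟨C, D, fun n => by rw [hcard, hcard]; exact h n⟩
  · intro hbot
    refine hword.2 (show (FreeMonoid.of (Fin.last d)).toList ∈ L from hy)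
      ((TwoSidedIdeal.mem_bot _).1 ?_)
    rw [← hbot]
    exact TwoSidedIdeal.subset_span rfl
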